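/- Let $G=(V,E)$ be a finite directed acyclic graph (parallel edges allowed) in which every edge has unit capacity, i.e. carries one symbol of a finite field $\mathbb F$ per time unit. Let $s_1,s_2,s_3$ and $t_1,t_2,t_3$ be vertices of $G$; source $s_i$ observes one independent symbol of $\mathbb F$ per time unit, which terminal $t_i$ has to recover (three unicast sessions of unit rate). A linear network code over $\mathbb F$ with vector length $T\ge 1$ replaces each edge by $T$ parallel edges and lets $s_i$ observe $T$ symbols $X_i^{(1)},\dots,X_i^{(T)}$; the symbol on each edge is a fixed $\mathbb F$-linear combination of the symbols on the edges entering its tail and of the source symbols observed at its tail. It is a solution if every $t_i$ can recover $X_i^{(1)},\dots,X_i^{(T)}$ from the symbols on its incoming edges. The instance is feasible if it has such a solution for some finite field $\mathbb F$ and some $T\ge 1$. Theorem. Suppose that the connectivity level is at least $[1~3~3]$, that is, the maximum flow from $s_1$ to $t_1$ is at least $1$, and the maximum flow from $s_i$ to $t_i$ is at least $3$ for $i=2,3$. Then the instance is feasible. Moreover there is a number $q_0$, depending only on the instance, such that over every finite field $\mathbb F$ with at least $q_0$ elements there is a solution with vector length $T=2$ that uses the two copies of the graph separately: no symbols are mixed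 across the two copies, in the first copy only $X_1^{(1)}$ and $X_2^{(1)},X_2^{(2)}$ are sent, and in the second copy only $X_1^{(2)}$ and $X_3^{(1)},X_3^{(2)}$ are sent. -/

import Mathlib

open Finset

/-- A directed acyclic multigraph with vertex set `V` and edge set `E`. Every edge has unit
capacity; an edge of larger capacity is represented by several parallel edges. -/
structure Network (V E : Type*) where
  tail : E → V
  head : E → V
  acyclic : ∀ v : V, ¬ Relation.TransGen (fun u w : V => ∃ e, tail e = u ∧ head e = w) v v

namespace Network

variable {V E : Type*} [Fintype E]

open Classical in
/-- The total value of `f` on the edges that enter `v`. -/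
noncomputable def inflow (G : Network V E) (f : E → ℕ) (v : V) : ℕ :=
  ∑ e with G.head e = v, f e

open Classical in
/-- The total value of `f` on the edges that leave `v`. -/
noncomputable def outflow (G : Network V E) (f : E → ℕ) (v : V) : ℕ :=
  ∑ e with G.tail e = v, f e

/-- `f` is a flow from `s` to `t` of value `k`: it respects the unit edge capacities, it is
conserved at every vertex other than `s` and `t`, and the net flow out of `s` is `k`. -/
structure IsFlow (G : Network V E) (s t : V) (f : E → ℕ) (k : ℕ) : Prop where
  capacity : ∀ e, f e ≤ 1
  conservation : ∀ v, v ≠ s → v ≠ t → G.inflow f v = G.outflow f v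
  value : G.inflow f s + k = G.outflow f s

/-- The maximum value of a flow from `s` to `t`. -/
noncomputable def maxFlow (G : Network V E) (s t : V) : ℕ :=
  sSup {k : ℕ | ∃ f : E → ℕ, G.IsFlow s t f k}

/-- The values of flows are bounded and the zero flow exists, so the supremum that defines
`maxFlow` is a maximum. -/
theorem le_maxFlow_iff (G : Network V E) (s t : V) (k : ℕ) :
    k ≤ G.maxFlow s t ↔ ∃ l, k ≤ l ∧ ∃ f : E → ℕ, G.IsFlow s t f l := by
  have hb : BddAbove {k : ℕ | ∃ f : E → ℕ, G.IsFlow s t f k} := by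
    refine ⟨Fintype.card E, ?_⟩
    rintro k ⟨f, hf⟩
    have h1 : k ≤ G.outflow f s := by have := hf.value; omega
    refine h1.trans ?_
    unfold outflow
    calc _ ≤ ∑ e, f e := Finset.sum_le_sum_of_subset (Finset.subset_univ _)
      _ ≤ ∑ _e : E, 1 := Finset.sum_le_sum fun e _ => hf.capacity e
      _ = _ := by simp
  have hne : {k : ℕ | ∃ f : E → ℕ, G.IsFlow s t f k}.Nonempty :=
    ⟨0, fun _ => 0, ⟨by simp, by simp [inflow, outflow], by simp [inflow, outflow]⟩⟩
  constructor
  · intro h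
    exact ⟨_, h, Nat.sSup_mem hne hb⟩
  · rintro ⟨l, hl, hf⟩
    exact hl.trans (le_csSup hb hf)

end Network

/-- A multiple unicast instance: a network, `n` source-terminal pairs, and integer rates. -/
structure UnicastInstance (V E : Type*) (n : ℕ) where
  net : Network V E
  src : Fin n → V
  trm : Fin n → V
  rate : Fin n → ℕ

namespace UnicastInstance

variable {V E : Type*} [Fintype E] {n : ℕ}

/-- The vector of the maximum flows between the sources and their terminals. -/
noncomputable def connectivityLevel (I : UnicastInstance V E n) : Fin n → ℕ :=
  fun i => I.net.maxFlow (I.src i) (I.trm i)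

/-- The source symbols over `T` time units: `⟨i, r, τ⟩` stands for the symbol that the `r`-th
unit-entropy source at the `i`-th source node emits at time `τ`. -/
abbrev Message (I : UnicastInstance V E n) (T : ℕ) : Type :=
  (i : Fin n) × (Fin (I.rate i) × Fin T)

open Classical in
/-- A linear network code over `F` for `T` uses of the network. Every edge `e` is replaced by the
`T` parallel edges `(e, a)`. The symbol on an edge is a linear combination, with the local coding
coefficients `mix` and `inject`, of the symbols on the edges that enter its tail and of the source
symbols observed at its tail. `signal x p` is the symbol on the edge `p` when the source symbols
are `x`; since the network is acyclic, `signal` is determined by the local coefficients. -/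
structure LinearCode (I : UnicastInstance V E n) (F : Type*) [Field F] (T : ℕ) where
  mix : E × Fin T → E × Fin T → F
  inject : I.Message T → E × Fin T → F
  signal : (I.Message T → F) → E × Fin T → F
  signal_eq : ∀ x p, signal x p =
    (∑ p' : E × Fin T with I.net.head p'.1 = I.net.tail p.1, mix p' p * signal x p') +
      ∑ m : I.Message T with I.src m.1 = I.net.tail p.1, inject m p * x m

/-- Every terminal recovers all symbols of its own source from the symbols on its input edges. -/
def LinearCode.IsSolution {I : UnicastInstance V E n} {F : Type*} [Field F] {T : ℕ}
    (c : I.LinearCode F T) : Prop :=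
  ∀ i : Fin n, ∃ dec : ({e : E // I.net.head e = I.trm i} × Fin T → F) →
      (Fin (I.rate i) × Fin T → F),
    ∀ x : I.Message T → F, dec (fun p => c.signal x (p.1.1, p.2)) = fun w => x ⟨i, w⟩

/-- The instance has a scalar (`T = 1`) or vector linear network coding solution over some finite
field. -/
def IsFeasible (I : UnicastInstance V E n) : Prop :=
  ∃ (F : Type) (_ : Field F) (_ : Finite F) (T : ℕ), 1 ≤ T ∧ ∃ c : I.LinearCode F T, c.IsSolution

/-- The code uses the two copies of the graph separately: symbols are never mixed across copies,
the first source sends one symbol in each copy, the second source sends only in the first copy and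
the third source sends only in the second copy. -/
structure LinearCode.SplitsCopies {I : UnicastInstance V E 3} {F : Type*} [Field F]
    (c : I.LinearCode F 2) : Prop where
  mix_eq : ∀ p' p, p'.2 ≠ p.2 → c.mix p' p = 0
  inject_first : ∀ m p, m.1 = 0 → m.2.2 ≠ p.2 → c.inject m p = 0
  inject_second : ∀ m p, m.1 = 1 → p.2 ≠ 0 → c.inject m p = 0
  inject_third : ∀ m p, m.1 = 2 → p.2 ≠ 1 → c.inject m p = 0

end UnicastInstance

/-! The two copies of the graph separate the problem into two instances with two sessions each, of
rates 1 and 2 (`exists_two_unicast_code`). In such an instance take a walk P of the first session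
and three edge-disjoint walks Q_i of the second, which carry symbols p and q_i: linear forms in x,
the symbol of the first source, and a vector z of length 3 at the second source. Initially p = x and
q_i = z_i. Edges are visited in a topological order; when P and Q_i share an edge, both carry α p +
q_i from there on.

The invariant `Decodable` says that p involves x, that the z-parts of the q_i are independent, and
that either no q_i involves x or some q_i equals p. A suitable α preserves it
(`Decodable.exists_mix`). Finally z is precoded into the kernel of the z-part of the final p, which
costs one dimension and leaves two free symbols. Then t_1 sees a nonzero multiple of x. If some q_i
equals p, the second terminal also learns x and can cancel it; otherwise x does not occur there. In
both cases it obtains z. -/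

namespace Network

/-! ### Topological ranks of edges, and walks -/

variable {V E : Type*}

/-- The list `l` of edges forms a walk from `u` to `t`. -/
def IsWalk (G : Network V E) : V → List E → V → Prop
  | u, [], t => u = t
  | u, e :: l, t => G.tail e = u ∧ IsWalk G (G.head e) l t

/-- The edges can be ranked injectively by natural numbers that increase along the network. -/
theorem exists_rank [Fintype E] (G : Network V E) :
    ∃ r : E → ℕ, Function.Injective r ∧ ∀ g e, G.head g = G.tail e → r g < r e := by
  classical
  let R : E → E → Prop := fun g e => G.head g = G.tail e
  have hR : ∀ g e, Relation.TransGen R g e →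
      Relation.TransGen (fun u w : V => ∃ e, G.tail e = u ∧ G.head e = w) (G.tail g) (G.tail e) := by
    intro g e h
    induction h with
    | single h => exact .single ⟨g, rfl, h⟩
    | tail _ h ih => exact ih.tail ⟨_, rfl, h⟩
  let h : E → ℕ := fun e => #{g | Relation.TransGen R g e}
  have hh : ∀ g e, R g e → h g < h e := by
    intro g e hge
    refine Finset.card_lt_card (Finset.ssubset_iff_subset_ne.2 ⟨?_, ?_⟩)
    · intro a ha
      simp only [Finset.mem_filter, Finset.mem_univ, true_and] at ha ⊢
      exact ha.tail hge
    · intro heq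
      have : g ∈ ({a | Relation.TransGen R a g} : Finset E) := by
        rw [heq]
        simpa using Relation.TransGen.single hge
      simp only [Finset.mem_filter, Finset.mem_univ, true_and] at this
      exact G.acyclic _ (hR _ _ this)
  let idx := Fintype.equivFin E
  -- Lexicographic order: number of predecessors first, with ties broken by an enumeration to get
  -- injectivity.
  refine ⟨fun e => h e * Fintype.card E + idx e, ?_, ?_⟩
  · intro a b hab
    have ha := (idx a).2
    have hb := (idx b).2
    have h1 := congrArg (· % Fintype.card E) hab
    simp only [Nat.mul_add_mod_self_right, Nat.mod_eq_of_lt ha, Nat.mod_eq_of_lt hb] at h1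
    exact idx.injective (Fin.ext h1)
  · intro g e hge
    have ha := (idx g).2
    have h1 : h g + 1 ≤ h e := hh g e hge
    have h2 := Nat.mul_le_mul_right (Fintype.card E) h1
    show h g * Fintype.card E + idx g < h e * Fintype.card E + idx e
    rw [Nat.add_mul] at h2
    omega

section Walk

variable {G : Network V E} {r : E → ℕ}

theorem IsWalk.rank_lt (hr : ∀ g e, G.head g = G.tail e → r g < r e) {t : V} {l : List E}
    {u : V} (h : G.IsWalk u l t) {g : E} (hg : G.head g = u) : ∀ e ∈ l, r g < r e := by
  induction l generalizing u g with
  | nil => simp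
  | cons a l ih =>
    obtain ⟨h1, h2⟩ := h
    have hga : r g < r a := hr g a (hg.trans h1.symm)
    intro e he
    rcases List.mem_cons.1 he with rfl | he
    · exact hga
    · exact hga.trans (ih h2 rfl e he)

theorem IsWalk.nodup (hr : ∀ g e, G.head g = G.tail e → r g < r e) {t : V} {l : List E}
    {u : V} (h : G.IsWalk u l t) : l.Nodup := by
  induction l generalizing u with
  | nil => simp
  | cons a l ih =>
    refine List.nodup_cons.2 ⟨fun ha => ?_, ih h.2⟩
    exact lt_irrefl _ (IsWalk.rank_lt hr h.2 rfl a ha)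

-- Heads and tails telescope along a walk, so only its ends are unbalanced; hence removing a walk
-- preserves flow conservation.
open Classical in
theorem IsWalk.count (G : Network V E) {t : V} {l : List E} {u : V} (h : G.IsWalk u l t) (v : V) :
    (l.map G.head).count v + (if v = u then 1 else 0) =
      (l.map G.tail).count v + (if v = t then 1 else 0) := by
  induction l generalizing u with
  | nil => cases h; simp
  | cons a l ih =>
    obtain ⟨h1, h2⟩ := h
    have := ih h2
    simp only [List.map_cons, List.count_cons, beq_iff_eq, h1, @eq_comm _ u v,
      @eq_comm _ (G.head a) v]
    omega

/-- Every edge of a walk is either its first edge or follows immediately, with respect to a rank,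
an edge of the walk that enters its tail. -/
theorem IsWalk.first_or_pred (hr : ∀ g e, G.head g = G.tail e → r g < r e) {t : V} {l : List E}
    {u : V} (h : G.IsWalk u l t) : ∀ e ∈ l, (G.tail e = u ∧ ∀ g ∈ l, r e ≤ r g) ∨
      ∃ g ∈ l, G.head g = G.tail e ∧ r g < r e ∧ ∀ a ∈ l, r a ≤ r g ∨ r e ≤ r a := by
  induction l generalizing u with
  | nil => simp
  | cons b l ih =>
    have hb := IsWalk.rank_lt hr h.2 (g := b) rfl
    intro e he
    rcases List.mem_cons.1 he with rfl | he
    · refine .inl ⟨h.1, fun g hg => ?_⟩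
      rcases List.mem_cons.1 hg with rfl | hg
      · exact le_rfl
      · exact (hb g hg).le
    · rcases ih h.2 e he with ⟨h1, h2⟩ | ⟨g, hg, h1, h2, h3⟩
      · refine .inr ⟨b, by simp, h1.symm, hb e he, fun a ha => ?_⟩
        rcases List.mem_cons.1 ha with rfl | ha
        · exact .inl le_rfl
        · exact .inr (h2 a ha)
      · refine .inr ⟨g, by simp [hg], h1, h2, fun a ha => ?_⟩
        rcases List.mem_cons.1 ha with rfl | ha
        · exact .inl (hb g hg).le
        · exact h3 a ha

theorem IsWalk.exists_last (hr : ∀ g e, G.head g = G.tail e → r g < r e) {t : V} {l : List E}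
    {u : V} (h : G.IsWalk u l t) (hl : l ≠ []) : ∃ e ∈ l, G.head e = t ∧ ∀ g ∈ l, r g ≤ r e := by
  induction l generalizing u with
  | nil => exact absurd rfl hl
  | cons b l ih =>
    rcases eq_or_ne l [] with rfl | hne
    · exact ⟨b, by simp, h.2, by simp⟩
    · obtain ⟨e, he, h1, h2⟩ := ih h.2 hne
      refine ⟨e, by simp [he], h1, fun g hg => ?_⟩
      rcases List.mem_cons.1 hg with rfl | hg
      · exact (IsWalk.rank_lt hr h.2 rfl e he).le
      · exact h2 g hg

end Walk

/-! ### Decomposition of flows into edge-disjoint walks -/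

section Flow

variable [Fintype E] {G : Network V E} {s t : V} {f : E → ℕ} {k : ℕ}

/-- A flow of positive value joins its source to its sink, and these are distinct. -/
theorem IsFlow.reach [Finite V] (hf : G.IsFlow s t f (k + 1)) :
    s ≠ t ∧ Relation.ReflTransGen (fun u w => ∃ e, f e = 1 ∧ G.tail e = u ∧ G.head e = w) s t := by
  classical
  have := Fintype.ofFinite V
  set step : V → V → Prop := fun u w => ∃ e, f e = 1 ∧ G.tail e = u ∧ G.head e = w
  let R : Finset V := {v | Relation.ReflTransGen step s v}
  have hs : s ∈ R := by simp [R, Relation.ReflTransGen.refl]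
  have hout : ∑ v ∈ R, G.outflow f v = ∑ e with G.tail e ∈ R, f e := by
    simp only [outflow, Finset.sum_filter]
    rw [Finset.sum_comm]
    refine Finset.sum_congr rfl fun e _ => by simp
  have hin : ∑ v ∈ R, G.inflow f v = ∑ e with G.head e ∈ R, f e := by
    simp only [inflow, Finset.sum_filter]
    rw [Finset.sum_comm]
    refine Finset.sum_congr rfl fun e _ => by simp
  -- No flow leaves the reachable set. If that set missed the sink, conservation would leave the
  -- positive surplus at `s`, a contradiction.
  have hle : ∑ v ∈ R, G.outflow f v ≤ ∑ v ∈ R, G.inflow f v := by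
    rw [hout, hin, Finset.sum_filter, Finset.sum_filter]
    refine Finset.sum_le_sum fun e _ => ?_
    rcases Nat.le_one_iff_eq_zero_or_eq_one.1 (hf.capacity e) with h0 | h1
    · simp [h0]
    · by_cases ht : G.tail e ∈ R
      · have : G.head e ∈ R := by
          simp only [R, Finset.mem_filter, Finset.mem_univ, true_and] at ht ⊢
          exact ht.tail ⟨e, h1, rfl, rfl⟩
        simp [ht, this]
      · simp [ht]
  have key : ¬ (∀ v ∈ R, v ≠ s → v ≠ t) := by
    intro h
    rw [← Finset.add_sum_erase _ _ hs, ← Finset.add_sum_erase _ _ hs] at hle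
    have h2 : ∑ v ∈ R.erase s, G.inflow f v = ∑ v ∈ R.erase s, G.outflow f v :=
      Finset.sum_congr rfl fun v hv => hf.conservation v (Finset.ne_of_mem_erase hv)
        (h v (Finset.mem_of_mem_erase hv) (Finset.ne_of_mem_erase hv))
    have := hf.value
    omega
  push Not at key
  obtain ⟨v, hv, hvs, rfl⟩ := key
  exact ⟨hvs.symm, by simpa [R] using hv⟩

theorem IsFlow.exists_walk [Finite V] (hf : G.IsFlow s t f (k + 1)) :
    ∃ l, l ≠ [] ∧ G.IsWalk s l t ∧ ∀ e ∈ l, f e = 1 := by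
  obtain ⟨hst, h⟩ := hf.reach
  have : ∃ l, G.IsWalk s l t ∧ ∀ e ∈ l, f e = 1 := by
    clear hst hf
    induction h using Relation.ReflTransGen.head_induction_on with
    | refl => exact ⟨[], rfl, by simp⟩
    | head h _ ih =>
      obtain ⟨e, h1, h2, h3⟩ := h
      obtain ⟨l, hl, hl'⟩ := ih
      exact ⟨e :: l, ⟨h2, h3 ▸ hl⟩, by simpa [h1] using hl'⟩
  obtain ⟨l, hl, hl'⟩ := this
  refine ⟨l, ?_, hl, hl'⟩
  rintro rfl
  exact hst hl

open Classical in
theorem sum_ite_mem_list (p : E → V) {l : List E} (hl : l.Nodup) (f : E → ℕ)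
    (hf : ∀ e ∈ l, f e = 1) (v : V) :
    ∑ e with p e = v, f e =
      (∑ e with p e = v, if e ∈ l then 0 else f e) + (l.map p).count v := by
  have : (l.map p).count v = ∑ e with p e = v, if e ∈ l then 1 else 0 := by
    rw [← Finset.sum_filter, Finset.sum_const, smul_eq_mul, mul_one, List.count,
      List.countP_map, List.countP_eq_length_filter,
      ← List.toFinset_card_of_nodup (hl.filter _)]
    congr 1
    ext e
    simp [and_comm]
  rw [this, ← Finset.sum_add_distrib]
  refine Finset.sum_congr rfl fun e _ => ?_
  by_cases h : e ∈ l <;> simp [h, hf]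

/-- Removing a walk from the source to the sink decreases the value of a flow by one. -/
theorem IsFlow.remove_walk (hf : G.IsFlow s t f (k + 1)) (hst : s ≠ t) {l : List E}
    (hl : G.IsWalk s l t) (hn : l.Nodup) (h1 : ∀ e ∈ l, f e = 1) [DecidableEq E] :
    G.IsFlow s t (fun e => if e ∈ l then 0 else f e) k := by
  classical
  have hin : ∀ v, G.inflow f v =
      G.inflow (fun e => if e ∈ l then 0 else f e) v + (l.map G.head).count v := fun v => by
    have := sum_ite_mem_list G.head hn f h1 v
    unfold inflow
    convert this
  have hout : ∀ v, G.outflow f v =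
      G.outflow (fun e => if e ∈ l then 0 else f e) v + (l.map G.tail).count v := fun v => by
    have := sum_ite_mem_list G.tail hn f h1 v
    unfold outflow
    convert this
  have hc := IsWalk.count G hl
  refine ⟨fun e => ?_, fun v hvs hvt => ?_, ?_⟩
  · split_ifs
    · omega
    · exact hf.capacity e
  · have := hf.conservation v hvs hvt
    rw [hin, hout] at this
    have h2 := hc v
    simp only [hvs, hvt, if_false] at h2
    omega
  · have := hf.value
    rw [hin, hout] at this
    have h2 := hc s
    simp only [hst, if_true, if_false] at h2
    omega

/-- A flow of value `k` contains `k` edge-disjoint walks from the source to the sink. -/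
theorem IsFlow.exists_disjoint_walks [Finite V] (hf : G.IsFlow s t f k) :
    ∃ l : Fin k → List E, (∀ i, l i ≠ [] ∧ G.IsWalk s (l i) t ∧ ∀ e ∈ l i, f e = 1) ∧
      ∀ i j, ∀ e ∈ l i, e ∈ l j → i = j := by
  classical
  induction k generalizing f with
  | zero => exact ⟨fun _ => [], fun i => i.elim0, fun i => i.elim0⟩
  | succ k ih =>
    obtain ⟨r, -, hr⟩ := G.exists_rank
    obtain ⟨w, hw0, hw, hw1⟩ := hf.exists_walk
    obtain ⟨l, hl, hd⟩ := ih (hf.remove_walk hf.reach.1 hw (hw.nodup hr) hw1)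
    have hl1 : ∀ i, ∀ e ∈ l i, e ∉ w ∧ f e = 1 := fun i e he => by
      have := (hl i).2.2 e he
      by_cases h : e ∈ w <;> simp_all
    refine ⟨Fin.cons w l, fun i => ?_, fun i j e => ?_⟩
    · refine Fin.cases ⟨hw0, hw, hw1⟩ (fun i => ?_) i
      exact ⟨(hl i).1, (hl i).2.1, fun e he => (hl1 i e he).2⟩
    · refine Fin.cases (Fin.cases ?_ (fun j => ?_) j) (fun i => Fin.cases ?_ (fun j => ?_) j) i
      · simp
      · simp only [Fin.cons_zero, Fin.cons_succ]
        exact fun h1 h2 => absurd h1 (hl1 j e h2).1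
      · simp only [Fin.cons_zero, Fin.cons_succ]
        exact fun h1 h2 => absurd h2 (hl1 i e h1).1
      · simp only [Fin.cons_succ]
        exact fun h1 h2 => congrArg _ (hd i j e h1 h2)

theorem exists_disjoint_walks_of_le_maxFlow [Finite V] (h : k ≤ G.maxFlow s t) :
    ∃ l : Fin k → List E, (∀ i, l i ≠ [] ∧ G.IsWalk s (l i) t) ∧
      ∀ i j, ∀ e ∈ l i, e ∈ l j → i = j := by
  obtain ⟨n, hn, f, hf⟩ := (G.le_maxFlow_iff s t k).1 h
  obtain ⟨l, hl, hd⟩ := hf.exists_disjoint_walks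
  refine ⟨fun i => l (Fin.castLE hn i), fun i => ⟨(hl _).1, (hl _).2.1⟩, fun i j e h1 h2 => ?_⟩
  exact Fin.castLE_injective hn (hd _ _ e h1 h2)

end Flow

end Network

/-- Each condition excludes at most one α, so three field elements suffice; for c = 0 the second one
holds because d ≠ 0. -/
theorem exists_mul_add_ne_zero {F : Type*} [Field F] [Finite F] (hF : 3 ≤ Nat.card F)
    {a b c d : F} (ha : a ≠ 0) (hd : d ≠ 0) : ∃ α : F, α * a + b ≠ 0 ∧ α * c + d ≠ 0 := by
  classical
  have := Fintype.ofFinite F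
  by_contra! h
  have hsub : (univ : Finset F) ⊆ {-b / a, -d / c} := by
    intro α _
    rw [Finset.mem_insert, Finset.mem_singleton]
    by_cases h1 : α * a + b = 0
    · left
      rw [eq_div_iff ha]
      linear_combination h1
    · right
      have h2 := h α h1
      have hc : c ≠ 0 := by
        rintro rfl
        simp_all
      rw [eq_div_iff hc]
      linear_combination h2
  have h1 := (Finset.card_le_card hsub).trans Finset.card_le_two
  rw [Finset.card_univ, ← Nat.card_eq_fintype_card] at h1
  omega

namespace Network

/-! ### Coding for two unicast sessions -/

section Coding

variable {V E F ι : Type*} [Field F]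

section Local

variable [Fintype E]

open Classical in
/-- `u` is a linear combination of the symbols `v` on the edges that enter the tail of `e` and of
the source symbols observed at the tail of `e`. -/
def IsLocal (G : Network V E) (s₁ s₂ : V) (v : E → F × (ι → F)) (e : E) (u : F × (ι → F)) : Prop :=
  ∃ (m : E → F) (a : F) (b : ι → F), u = (∑ g with G.head g = G.tail e, m g • v g) +
    (if G.tail e = s₁ then (a, 0) else 0) + (if G.tail e = s₂ then (0, b) else 0)

variable {G : Network V E} {s₁ s₂ : V} {v : E → F × (ι → F)} {e : E}

theorem IsLocal.smul_add {u w : F × (ι → F)} (hu : G.IsLocal s₁ s₂ v e u)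
    (hw : G.IsLocal s₁ s₂ v e w) (α : F) : G.IsLocal s₁ s₂ v e (α • u + w) := by
  obtain ⟨m, a, b, rfl⟩ := hu
  obtain ⟨m', a', b', rfl⟩ := hw
  refine ⟨α • m + m', α • a + a', α • b + b', ?_⟩
  have : ∀ g, (α • m + m') g • v g = α • m g • v g + m' g • v g := fun g => by
    simp [add_smul, mul_smul]
  simp only [this, Finset.sum_add_distrib, ← Finset.smul_sum]
  split_ifs <;> ext <;> simp <;> ring

theorem isLocal_zero : G.IsLocal s₁ s₂ v e 0 :=
  ⟨0, 0, 0, by split_ifs <;> ext <;> simp⟩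

theorem isLocal_of_head_eq {g : E} (h : G.head g = G.tail e) : G.IsLocal s₁ s₂ v e (v g) := by
  classical
  refine ⟨Pi.single g 1, 0, 0, ?_⟩
  rw [Finset.sum_eq_single_of_mem g (by simpa using h)]
  · split_ifs <;> ext <;> simp
  · intro b _ hb
    simp [hb]

theorem isLocal_first (h : G.tail e = s₁) : G.IsLocal s₁ s₂ v e (1, 0) :=
  ⟨0, 1, 0, by split_ifs <;> ext <;> simp⟩

theorem isLocal_second (h : G.tail e = s₂) (b : ι → F) : G.IsLocal s₁ s₂ v e (0, b) :=
  ⟨0, 0, b, by split_ifs <;> ext <;> simp⟩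

end Local

variable [Fintype ι] [DecidableEq ι]

/-- The symbols `p`, on the path of the first session, and `q i`, on the paths of the second
session, are given by their coefficients at the symbol of the first source and at the symbols of
the second source. They are decodable for the second terminal after precoding. -/
structure Decodable (p : F × (ι → F)) (q : ι → F × (ι → F)) : Prop where
  fst_ne : p.1 ≠ 0
  det_ne : (Matrix.of fun i => (q i).2).det ≠ 0
  fst_eq_or_eq : (∀ i, (q i).1 = 0) ∨ ∃ i, p = q i

theorem decodable_init : Decodable ((1, 0) : F × (ι → F)) fun i => (0, Pi.single i 1) := by
  refine ⟨one_ne_zero, ?_, .inl fun _ => rfl⟩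
  have : (Matrix.of fun i => (Pi.single i 1 : ι → F)) = 1 := by
    ext i j
    simp [Matrix.one_apply, Pi.single_apply, eq_comm]
  simp [this]

/-- The new x-coefficient and, by linearity in row i, the new determinant are affine in α. The first
has nonzero slope and the second nonzero constant term, so some α avoids both zeros. -/
theorem Decodable.exists_mix [Finite F] (hF : 3 ≤ Nat.card F) {p : F × (ι → F)}
    {q : ι → F × (ι → F)} (h : Decodable p q) (i : ι) :
    ∃ α : F, Decodable (α • p + q i) (Function.update q i (α • p + q i)) := by
  obtain ⟨α, h1, h2⟩ := exists_mul_add_ne_zero hF (b := (q i).1)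
    (c := ((Matrix.of fun i => (q i).2).updateRow i p.2).det) h.fst_ne h.det_ne
  refine ⟨α, by simpa using h1, ?_, .inr ⟨i, by simp⟩⟩
  have : (Matrix.of fun j => (Function.update q i (α • p + q i) j).2) =
      (Matrix.of fun j => (q j).2).updateRow i (α • p.2 + (q i).2) := by
    ext j k
    rcases eq_or_ne j i with rfl | hj
    · simp
    · simp [hj]
  rw [this, Matrix.det_updateRow_add, Matrix.det_updateRow_smul]
  convert h2 using 3
  exact congrArg _ (Matrix.updateRow_eq_self (Matrix.of fun i => (q i).2) i)

/-- A sequence of decodable pairs that is mixed whenever `n` is the rank of a common edge. -/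
theorem exists_states [Finite F] (hF : 3 ≤ Nat.card F) (A : ℕ → ι → Prop) :
    ∃ (p : ℕ → F × (ι → F)) (q : ℕ → ι → F × (ι → F)),
      (∀ n, Decodable (p n) (q n)) ∧ p 0 = (1, 0) ∧ (q 0 = fun i => (0, Pi.single i 1)) ∧
      ∀ n, ((∀ i, ¬ A n i) ∧ p (n + 1) = p n ∧ q (n + 1) = q n) ∨
        ∃ i, A n i ∧ ∃ α : F, p (n + 1) = α • p n + q n i ∧
          q (n + 1) = Function.update (q n) i (p (n + 1)) := by
  let S := {s : (F × (ι → F)) × (ι → F × (ι → F)) // Decodable s.1 s.2}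
  have step : ∀ (n : ℕ) (s : S), ∃ s' : S,
      ((∀ i, ¬ A n i) ∧ s'.1.1 = s.1.1 ∧ s'.1.2 = s.1.2) ∨
        ∃ i, A n i ∧ ∃ α : F, s'.1.1 = α • s.1.1 + s.1.2 i ∧
          s'.1.2 = Function.update s.1.2 i s'.1.1 := by
    rintro n ⟨⟨p, q⟩, hs⟩
    by_cases h : ∃ i, A n i
    · obtain ⟨i, hi⟩ := h
      obtain ⟨α, hα⟩ := hs.exists_mix hF i
      exact ⟨⟨(_, _), hα⟩, .inr ⟨i, hi, α, rfl, rfl⟩⟩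
    · exact ⟨⟨(p, q), hs⟩, .inl ⟨not_exists.1 h, rfl, rfl⟩⟩
  choose next hnext using step
  let st : ℕ → S := fun n => Nat.rec ⟨(_, _), decodable_init⟩ next n
  exact ⟨fun n => (st n).1.1, fun n => (st n).1.2, fun n => (st n).2, rfl, rfl,
    fun n => hnext n (st n)⟩

variable [Fintype E] {G : Network V E} {s₁ s₂ : V}

/-- A walk `P` of the first session and edge-disjoint walks `Q i` of the second session carry
symbols that obey the local coding rule and reach the terminals as a decodable pair. -/
theorem exists_decodable_symbols [Finite F] (hF : 3 ≤ Nat.card F) {t₁ t₂ : V} {P : List E}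
    (hP : G.IsWalk s₁ P t₁) (hP0 : P ≠ []) {Q : ι → List E}
    (hQ : ∀ i, Q i ≠ [] ∧ G.IsWalk s₂ (Q i) t₂) (hd : ∀ i j, ∀ e ∈ Q i, e ∈ Q j → i = j) :
    ∃ (v : E → F × (ι → F)) (p : F × (ι → F)) (q : ι → F × (ι → F)), Decodable p q ∧
      (∀ e, G.IsLocal s₁ s₂ v e (v e)) ∧ (∃ e, G.head e = t₁ ∧ v e = p) ∧
      ∀ i, ∃ e, G.head e = t₂ ∧ v e = q i := by
  classical
  obtain ⟨r, hinj, hr⟩ := G.exists_rank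
  -- Time is rank: the states at `r e` and `r e + 1` are those just before and just after `e` is
  -- visited.
  obtain ⟨p, q, hdec, hp0, hq0, hstep⟩ := exists_states (F := F) (ι := ι) hF
    fun n i => ∃ e, r e = n ∧ e ∈ P ∧ e ∈ Q i
  have hpstep : ∀ n, (∀ e ∈ P, r e ≠ n) → p (n + 1) = p n := by
    intro n hn
    rcases hstep n with ⟨-, h, -⟩ | ⟨i, ⟨e, rfl, he, -⟩, -⟩
    · exact h
    · exact absurd rfl (hn e he)
  have hqstep : ∀ i n, (∀ e ∈ Q i, r e ≠ n) → q (n + 1) i = q n i := by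
    intro i n hn
    rcases hstep n with ⟨-, -, h⟩ | ⟨j, ⟨e, rfl, -, he⟩, α, -, h⟩
    · rw [h]
    · rcases eq_or_ne i j with rfl | hij
      · exact absurd rfl (hn e he)
      · rw [h, Function.update_of_ne hij]
  have hconst : ∀ {X : Type _} (x : ℕ → X) (l : List E),
      (∀ n, (∀ e ∈ l, r e ≠ n) → x (n + 1) = x n) →
      ∀ a b, a ≤ b → (∀ e ∈ l, r e < a ∨ b ≤ r e) → x b = x a := by
    intro X x l hx a b hab
    induction b, hab using Nat.le_induction with
    | base => exact fun _ => rfl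
    | succ b hab ih =>
      intro h
      rw [hx b fun e he => by have := h e he; omega,
        ih fun e he => by have := h e he; omega]
  have hp1 : ∀ e ∈ P, (∀ i, e ∉ Q i) → p (r e + 1) = p (r e) := by
    intro e he hn
    rcases hstep (r e) with ⟨-, h, -⟩ | ⟨i, ⟨g, hg, -, hgi⟩, -⟩
    · exact h
    · exact absurd (hinj hg ▸ hgi) (hn i)
  have hq1 : ∀ i, ∀ e ∈ Q i, e ∉ P → q (r e + 1) i = q (r e) i := by
    intro i e he hn
    rcases hstep (r e) with ⟨-, -, h⟩ | ⟨i, ⟨g, hg, hgP, -⟩, -⟩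
    · rw [h]
    · exact absurd (hinj hg ▸ hgP) hn
  have hpq : ∀ i, ∀ e ∈ Q i, e ∈ P → q (r e + 1) i = p (r e + 1) ∧
      ∃ α : F, q (r e + 1) i = α • p (r e) + q (r e) i := by
    intro i e he heP
    rcases hstep (r e) with ⟨h, -, -⟩ | ⟨j, ⟨g, hg, -, hgj⟩, α, h1, h2⟩
    · exact absurd ⟨e, rfl, heP, he⟩ (h i)
    · obtain rfl : i = j := hd i j e he (hinj hg ▸ hgj)
      have : q (r e + 1) i = p (r e + 1) := by rw [h2, Function.update_self]
      exact ⟨this, α, this.trans h1⟩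
  -- On an edge shared with P the choice of q is harmless, since both symbols agree after mixing
  -- (`hpq`).
  let v : E → F × (ι → F) := fun e =>
    if h : ∃ i, e ∈ Q i then q (r e + 1) h.choose else if e ∈ P then p (r e + 1) else 0
  have hvQ : ∀ i, ∀ e ∈ Q i, v e = q (r e + 1) i := by
    intro i e he
    have h : ∃ i, e ∈ Q i := ⟨i, he⟩
    simp only [v, dif_pos h, hd _ _ e h.choose_spec he]
  have hvP : ∀ e ∈ P, v e = p (r e + 1) := by
    intro e he
    by_cases h : ∃ i, e ∈ Q i
    · obtain ⟨i, hi⟩ := h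
      rw [hvQ i e hi, (hpq i e hi he).1]
    · simp only [v, dif_neg h, if_pos he]
  have hlP : ∀ e ∈ P, G.IsLocal s₁ s₂ v e (p (r e)) := by
    intro e he
    rcases hP.first_or_pred hr e he with ⟨h1, h2⟩ | ⟨g, hg, h1, h2, h3⟩
    · rw [hconst p P hpstep 0 (r e) (Nat.zero_le _) fun a ha => .inr (h2 a ha), hp0]
      exact isLocal_first h1
    · rw [hconst p P hpstep (r g + 1) (r e) h2 fun a ha => by have := h3 a ha; omega, ← hvP g hg]
      exact isLocal_of_head_eq h1
  have hlQ : ∀ i, ∀ e ∈ Q i, G.IsLocal s₁ s₂ v e (q (r e) i) := by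
    intro i e he
    rcases (hQ i).2.first_or_pred hr e he with ⟨h1, h2⟩ | ⟨g, hg, h1, h2, h3⟩
    · rw [hconst (q · i) (Q i) (hqstep i) 0 (r e) (Nat.zero_le _) fun a ha => .inr (h2 a ha), hq0]
      exact isLocal_second h1 _
    · rw [hconst (q · i) (Q i) (hqstep i) (r g + 1) (r e) h2
        fun a ha => by have := h3 a ha; omega, ← hvQ i g hg]
      exact isLocal_of_head_eq h1
  -- Any time after all edges have been visited would do.
  let N := ∑ e, (r e + 1)
  have hN : ∀ e, r e + 1 ≤ N := fun e =>
    Finset.single_le_sum (f := fun e => r e + 1) (fun _ _ => Nat.zero_le _) (Finset.mem_univ e)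
  refine ⟨v, p N, q N, hdec N, fun e => ?_, ?_, fun i => ?_⟩
  · by_cases hQe : ∃ i, e ∈ Q i
    · obtain ⟨i, hi⟩ := hQe
      rw [hvQ i e hi]
      by_cases hPe : e ∈ P
      · obtain ⟨-, α, h⟩ := hpq i e hi hPe
        rw [h]
        exact (hlP e hPe).smul_add (hlQ i e hi) α
      · rw [hq1 i e hi hPe]
        exact hlQ i e hi
    · by_cases hPe : e ∈ P
      · rw [hvP e hPe, hp1 e hPe (not_exists.1 hQe)]
        exact hlP e hPe
      · simp only [v, dif_neg hQe, if_neg hPe]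
        exact isLocal_zero
  · obtain ⟨e, he, h1, h2⟩ := hP.exists_last hr hP0
    refine ⟨e, h1, ?_⟩
    rw [hvP e he, hconst p P hpstep (r e + 1) N (hN e) fun a ha => by have := h2 a ha; omega]
  · obtain ⟨e, he, h1, h2⟩ := (hQ i).2.exists_last hr (hQ i).1
    refine ⟨e, h1, ?_⟩
    rw [hvQ i e he, hconst (q · i) (Q i) (hqstep i) (r e + 1) N (hN e)
      fun a ha => by have := h2 a ha; omega]

open Classical in
/-- Two unicast sessions of rates `1` and `m` with maximum flows at least `1` and `m + 1` have a
scalar linear solution. -/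
theorem exists_two_unicast_code [Finite V] [Finite F] (hF : 3 ≤ Nat.card F) (G : Network V E)
    (s₁ s₂ t₁ t₂ : V) {m : ℕ} (h1 : 1 ≤ G.maxFlow s₁ t₁) (h2 : m + 1 ≤ G.maxFlow s₂ t₂) :
    ∃ (mix : E → E → F) (inj₁ : E → F) (inj₂ : Fin m → E → F) (sig : F → (Fin m → F) → E → F),
      (∀ x y e, sig x y e = (∑ g with G.head g = G.tail e, mix g e * sig x y g) +
        ((if G.tail e = s₁ then inj₁ e * x else 0) +
          if G.tail e = s₂ then ∑ j, inj₂ j e * y j else 0)) ∧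
      (∀ x y x' y', (∀ e, G.head e = t₁ → sig x y e = sig x' y' e) → x = x') ∧
      ∀ x y x' y', (∀ e, G.head e = t₂ → sig x y e = sig x' y' e) → y = y' := by
  obtain ⟨P, hP, -⟩ := exists_disjoint_walks_of_le_maxFlow h1
  obtain ⟨Q, hQ, hd⟩ := exists_disjoint_walks_of_le_maxFlow h2
  obtain ⟨v, p, q, hdec, hv, ⟨e₁, he₁, hve₁⟩, hvq⟩ :=
    exists_decodable_symbols hF (hP 0).2 (hP 0).1 hQ hd
  choose mix a b hv using hv
  -- The precoder `C` maps into the kernel of this form, so the final symbol on P depends on x only.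
  let φ : (Fin (m + 1) → F) →ₗ[F] F := ∑ i, p.2 i • LinearMap.proj i
  have hφ : ∀ z, φ z = p.2 ⬝ᵥ z := fun z => by simp [φ, dotProduct]
  have hrank : m ≤ Module.finrank F (LinearMap.ker φ) := by
    have h3 := LinearMap.finrank_range_add_finrank_ker φ
    have h4 := Submodule.finrank_le (LinearMap.range φ)
    simp only [Module.finrank_fin_fun, Module.finrank_self] at h3 h4
    omega
  obtain ⟨c, hc⟩ := exists_linearIndependent_of_le_finrank hrank
  have hc' : LinearIndependent F fun j => (c j : Fin (m + 1) → F) :=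
    hc.map' (LinearMap.ker φ).subtype (Submodule.ker_subtype _)
  let C : (Fin m → F) →ₗ[F] (Fin (m + 1) → F) := Fintype.linearCombination F fun j => (c j).1
  have hCinj : Function.Injective C := hc'.fintypeLinearCombination_injective
  have hCker : ∀ y, p.2 ⬝ᵥ C y = 0 := fun y => by
    rw [← hφ]
    have : C y = ∑ j, y j • (c j).1 := Fintype.linearCombination_apply ..
    rw [this, map_sum]
    refine Finset.sum_eq_zero fun j _ => ?_
    rw [map_smul, LinearMap.mem_ker.1 (c j).2, smul_zero]
  let ψ : F → (Fin m → F) → F × (Fin (m + 1) → F) →ₗ[F] F := fun x y =>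
    { toFun := fun u => u.1 * x + u.2 ⬝ᵥ C y
      map_add' := fun u w => by simp only [Prod.fst_add, Prod.snd_add, add_dotProduct]; ring
      map_smul' := fun α u => by
        simp only [Prod.smul_fst, Prod.smul_snd, smul_dotProduct, smul_eq_mul, RingHom.id_apply]
        ring }
  refine ⟨fun g e => mix e g, a, fun j e => b e ⬝ᵥ (c j).1, fun x y e => ψ x y (v e),
    fun x y e => ?_, ?_, ?_⟩
  · have hb : b e ⬝ᵥ C y = ∑ j, (b e ⬝ᵥ (c j).1) * y j := by
      have : C y = ∑ j, y j • (c j).1 := Fintype.linearCombination_apply ..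
      rw [this, dotProduct_sum]
      simp only [dotProduct_smul, smul_eq_mul, mul_comm]
    beta_reduce
    conv_lhs => rw [hv e]
    rw [map_add, map_add, map_sum, add_assoc]
    simp only [map_smul, smul_eq_mul, apply_ite (ψ x y), map_zero]
    simp only [← hb]
    simp [ψ]
  · intro x y x' y' h
    have h3 := h e₁ he₁
    beta_reduce at h3
    rw [hve₁] at h3
    simpa [ψ, hCker, hdec.fst_ne] using h3
  · intro x y x' y' h
    have h3 : ∀ i, (q i).1 * (x - x') + (q i).2 ⬝ᵥ C (y - y') = 0 := fun i => by
      obtain ⟨e, he, hve⟩ := hvq i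
      have h3 := h e he
      beta_reduce at h3
      rw [hve] at h3
      simp only [ψ, LinearMap.coe_mk, AddHom.coe_mk] at h3
      rw [map_sub, dotProduct_sub]
      linear_combination h3
    -- Either x is absent from all q_i, or some q_i is p, whose precoded value determines x.
    have h4 : ∀ i, (q i).1 * (x - x') = 0 := by
      rcases hdec.fst_eq_or_eq with h0 | ⟨i, hi⟩
      · simp [h0]
      · have := h3 i
        rw [← hi, hCker, add_zero] at this
        simp [(mul_eq_zero.1 this).resolve_left hdec.fst_ne]
    have h5 : C (y - y') = 0 := by
      refine Matrix.eq_zero_of_mulVec_eq_zero hdec.det_ne (funext fun i => ?_)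
      have := h3 i
      rwa [h4, zero_add] at this
    exact sub_eq_zero.1 (hCinj (h5.trans (map_zero C).symm))

end Coding

end Network

/-! ### Combining the two copies -/

/-- Over a field with at least three elements, the two copies of the graph are used as two instances
with two unicast sessions of rates `1` and `2`. -/
theorem exists_split_solution {V E : Type*} [Finite V] [Fintype E]
    (I : UnicastInstance V E 3) (hrate : ∀ i, I.rate i = 1)
    (hconn : ![1, 3, 3] ≤ I.connectivityLevel) (F : Type) [Field F] [Finite F]
    (hF : 3 ≤ Nat.card F) : ∃ c : I.LinearCode F 2, c.IsSolution ∧ c.SplitsCopies := by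
  classical
  obtain ⟨G, src, trm, rate⟩ := I
  obtain rfl : rate = fun _ => 1 := funext hrate
  have h0 : 1 ≤ G.maxFlow (src 0) (trm 0) := hconn 0
  have h1 : 2 + 1 ≤ G.maxFlow (src 1) (trm 1) := hconn 1
  have h2 : 2 + 1 ≤ G.maxFlow (src 2) (trm 2) := hconn 2
  have h : ∀ k : Fin 2, 2 + 1 ≤ G.maxFlow (src k.succ) (trm k.succ) := by
    intro k
    fin_cases k
    · exact h1
    · exact h2
  choose mix inj₁ inj₂ sig hsig hdec₁ hdec₂ using fun k : Fin 2 =>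
    G.exists_two_unicast_code hF (src 0) (src k.succ) (trm 0) (trm k.succ) h0 (h k)
  refine ⟨⟨fun p' p => if p'.2 = p.2 then mix p.2 p'.1 p.1 else 0,
    -- Copy k serves session k + 1, whose two time units act as the two symbols of one scalar code;
    -- the first source sends its k-th symbol there.
    fun m p => if m.1 = 0 then (if m.2.2 = p.2 then inj₁ p.2 p.1 else 0)
      else if m.1 = p.2.succ then inj₂ p.2 m.2.2 p.1 else 0,
    fun x p => sig p.2 (x ⟨0, 0, p.2⟩) (fun j => x ⟨p.2.succ, 0, j⟩) p.1, ?_⟩, ?_, ?_⟩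
  · rintro x ⟨e, k⟩
    dsimp only
    rw [hsig]
    congr 1
    · simp only [Finset.sum_filter, Fintype.sum_prod_type]
      refine Finset.sum_congr rfl fun g _ => ?_
      simp
    · simp only [Finset.sum_filter]
      rw [Fintype.sum_sigma]
      simp only [Fintype.sum_prod_type, Fin.sum_univ_three]
      fin_cases k <;> simp [eq_comm (a := src _)]
  · intro i
    have hex : ∀ x x' : (i : Fin 3) × (Fin 1 × Fin 2) → F,
        (∀ e, G.head e = trm i → ∀ k : Fin 2,
          sig k (x ⟨0, 0, k⟩) (fun j => x ⟨k.succ, 0, j⟩) e =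
          sig k (x' ⟨0, 0, k⟩) (fun j => x' ⟨k.succ, 0, j⟩) e) →
        (fun w => x ⟨i, w⟩) = fun w => x' ⟨i, w⟩ := by
      intro x x' hx
      ext ⟨r, k⟩
      obtain rfl : r = 0 := Subsingleton.elim _ _
      induction i using Fin.cases with
      | zero => exact hdec₁ k _ _ _ _ fun e he => hx e he k
      | succ i => exact congrFun (hdec₂ i _ _ _ _ fun e he => hx e he i) k
    -- By `hex` the received symbols determine the message; on unattainable inputs the decoder
    -- returns 0.
    refine ⟨Function.extend
      (fun (x : (i : Fin 3) × (Fin 1 × Fin 2) → F) (p : {e // G.head e = trm i} × Fin 2) =>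
        sig p.2 (x ⟨0, 0, p.2⟩) (fun j => x ⟨p.2.succ, 0, j⟩) p.1.1)
      (fun x w => x ⟨i, w⟩) 0, fun x => ?_⟩
    refine Function.FactorsThrough.extend_apply (fun x x' hx => ?_) _ x
    exact hex x x' fun e he k => congrFun hx (⟨e, he⟩, k)
  · refine ⟨fun p' p hp => if_neg hp, ?_, ?_, ?_⟩
    · rintro m p hm hp
      simp [hm, hp]
    · rintro m ⟨e, k⟩ hm hp
      obtain rfl : k = 1 := Fin.eq_one_of_ne_zero k hp
      simp [hm]
    · rintro m ⟨e, k⟩ hm hp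
      obtain rfl : k = 0 := by
        by_contra hk
        exact hp (Fin.eq_one_of_ne_zero k hk)
      simp [hm]

theorem mainTheorem3 {V E : Type*} [Finite V] [Fintype E]
    (I : UnicastInstance V E 3) (hrate : ∀ i, I.rate i = 1)
    (hconn : ![1, 3, 3] ≤ I.connectivityLevel) :
    I.IsFeasible ∧
      ∃ q₀ : ℕ, ∀ (F : Type) [Field F] [Finite F], q₀ ≤ Nat.card F →
        ∃ c : I.LinearCode F 2, c.IsSolution ∧ c.SplitsCopies := by
  refine ⟨?_, 3, fun F _ _ hF => exists_split_solution I hrate hconn F hF⟩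
  have : Fact (Nat.Prime 3) := ⟨Nat.prime_three⟩
  obtain ⟨c, hc, -⟩ := exists_split_solution I hrate hconn (ZMod 3) (by simp)
  exact ⟨ZMod 3, inferInstance, inferInstance, 2, one_le_two, c, hc⟩
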